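/- Let $d,k\in\mathbb{N}$ with $1\le k\le d$, let $p>0$ be real, and let $\mathcal{M}_d$ be the set of complex $d\times d$ matrices. For a Hermitian $A\in\mathcal{M}_d$ let $\lambda_1^\uparrow(A)\le\dots\le\lambda_d^\uparrow(A)$ be its eigenvalues in increasing order, and for $T\in\mathcal{M}_d$ let $s_1^\uparrow(T)\le\dots\le s_d^\uparrow(T)$ be its singular values in increasing order, both counted with multiplicity. Let $\mathcal{G}\subseteq\mathcal{M}_d$ be a set of matrices such that every $G\in\mathcal{G}$ satisfies $$\operatorname{Tr}[G+G^*]-p\sum_{i=1}^k\lambda_i^\uparrow(G+G^*)\le 0,$$ where $G^*$ is the conjugate transpose of $G$. Then every $T$ in the closure $\overline{\mathcal{D}}_{\mathcal{G}}$ of the set $$\mathcal{D}_{\mathcal{G}}=\Bigl\{\,\prod_{i=1}^n e^{G_i}\;:\;n\ge 1,\ G_1,\dots,G_n\in\mathcal{G}\Bigr\}\subseteq\mathcal{M}_d$$ satisfies $$|\det T|\le\Bigl(\prod_{i=1}^k s_i^\uparrow(T)\Bigr)^p.$$ -/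

import Mathlib

namespace MarkovDiv

/-- The eigenvalues of a Hermitian `d × d` matrix, with multiplicity, in increasing order:
`eigAsc hA i` is the `(i+1)`-st smallest eigenvalue. (`Matrix.IsHermitian.eigenvalues₀` lists them
in decreasing order.) -/
noncomputable def eigAsc {d : ℕ} {A : Matrix (Fin d) (Fin d) ℂ} (hA : A.IsHermitian)
    (i : Fin d) : ℝ :=
  hA.eigenvalues₀ (Fin.cast (Fintype.card_fin d).symm i.rev)

/-- The singular values of a `d × d` matrix, with multiplicity, in increasing order:
`singAsc T i` is the `(i+1)`-st smallest singular value. (`LinearMap.singularValues` lists them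
in decreasing order, starting from index `0`.) -/
noncomputable def singAsc {d : ℕ} (T : Matrix (Fin d) (Fin d) ℂ) (i : Fin d) : ℝ :=
  (Matrix.toEuclideanLin T).singularValues (i.rev : ℕ)

/-- The set of all finite products `e^{G 0} ⋯ e^{G (n-1)}`, `n ≥ 1`, of exponentials of elements
of `𝒢`. -/
def divisibleSet {d : ℕ} (𝒢 : Set (Matrix (Fin d) (Fin d) ℂ)) :
    Set (Matrix (Fin d) (Fin d) ℂ) :=
  {T | ∃ n : ℕ, 1 ≤ n ∧ ∃ G : Fin n → Matrix (Fin d) (Fin d) ℂ,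
    (∀ i, G i ∈ 𝒢) ∧ (List.ofFn fun i => NormedSpace.exp (G i)).prod = T}

/-- `T` is Markovian divisible with respect to `𝒢`: it lies in the closure of the set of finite
products of exponentials of elements of `𝒢`. -/
def MarkovianDivisible {d : ℕ} (𝒢 : Set (Matrix (Fin d) (Fin d) ℂ))
    (T : Matrix (Fin d) (Fin d) ℂ) : Prop :=
  T ∈ closure (divisibleSet 𝒢)

end MarkovDiv

open scoped Matrix Nat Matrix.Norms.L2Operator

namespace Matrix

section CauchyBinet

variable {m n R : Type*} [Fintype m] [DecidableEq m] [Fintype n] [CommRing R]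

/-! The property `ExpandsVolume k p T`, i.e. `|det T|² · gramDet V ^ p ≤ gramDet (T V) ^ p` for all
`d × k` matrices `V`, survives products and limits, so it passes from the exponentials to the whole
closure. Taking for `V` the right singular vectors of the `k` smallest singular values then gives
the claim (`exists_gramDet_eq_prod_singAsc`).

For one exponential, let `c` be the sum of the `k` smallest eigenvalues of `G + Gᴴ`. By Cauchy–Binet
in an eigenbasis, `gramDet (exp (t G) V)` has derivative at least `c` times itself, whence
`exp_mul_gramDet_le`. The hypothesis `Tr (G + Gᴴ) ≤ p c` and `|det (exp G)|² ≤ exp (Tr (G + Gᴴ))`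
finish the estimate. -/

theorem det_mul_eq_sum_submatrix (A : Matrix m n R) (B : Matrix n m R) :
    (A * B).det = ∑ f : m → n, (A.submatrix id f).det * ∏ i, B (f i) i := by
  classical
  simp only [det_apply', mul_apply, Finset.prod_univ_sum, Finset.mul_sum, Fintype.piFinset_univ]
  rw [Finset.sum_comm]
  refine Finset.sum_congr rfl fun f _ ↦ ?_
  rw [Finset.sum_mul]
  refine Finset.sum_congr rfl fun σ _ ↦ ?_
  rw [Finset.prod_mul_distrib, mul_assoc]
  rfl

/-- The **Cauchy–Binet formula**, summed over all functions instead of over subsets. -/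
theorem factorial_mul_det_mul (A : Matrix m n R) (B : Matrix n m R) :
    ((Fintype.card m)! : R) * (A * B).det =
      ∑ f : m → n, (A.submatrix id f).det * (B.submatrix f id).det := by
  classical
  -- Replacing `f` by `f ∘ τ` permutes the columns of the minor of `A` and costs a sign. Summing
  -- over all `τ` assembles the minor of `B`; this is the origin of the factorial.
  have key (τ : Equiv.Perm m) : (A * B).det = ∑ f : m → n,
      (A.submatrix id f).det * ((Equiv.Perm.sign τ : ℤ) * ∏ i, B (f (τ i)) i) := by
    rw [det_mul_eq_sum_submatrix, ← (Equiv.arrowCongr τ.symm (Equiv.refl n)).sum_comp]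
    refine Finset.sum_congr rfl fun f _ ↦ ?_
    have h : A.submatrix id (Equiv.arrowCongr τ.symm (Equiv.refl n) f) =
        (A.submatrix id f).submatrix id τ := rfl
    rw [h, det_permute']
    simp only [Equiv.arrowCongr_apply, Equiv.symm_symm, Function.comp_apply, Equiv.refl_apply]
    ring
  calc ((Fintype.card m)! : R) * (A * B).det = ∑ τ : Equiv.Perm m, (A * B).det := by
        rw [Finset.sum_const, Finset.card_univ, Fintype.card_perm, nsmul_eq_mul]
    _ = ∑ τ : Equiv.Perm m, ∑ f : m → n,
          (A.submatrix id f).det * ((Equiv.Perm.sign τ : ℤ) * ∏ i, B (f (τ i)) i) :=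
        Finset.sum_congr rfl fun τ _ ↦ key τ
    _ = _ := by
        rw [Finset.sum_comm]
        refine Finset.sum_congr rfl fun f _ ↦ ?_
        rw [← Finset.mul_sum, det_apply' (B.submatrix f id)]
        rfl

end CauchyBinet

/-- The congruence `N ↦ Vᴴ N V` as a real continuous linear map. -/
noncomputable def congruenceCLM {m n : Type*} [Fintype m] [DecidableEq m] [Fintype n]
    [DecidableEq n] (V : Matrix n m ℂ) : Matrix n n ℂ →L[ℝ] Matrix m m ℂ :=
  LinearMap.toContinuousLinearMap
    { toFun := fun N ↦ Vᴴ * N * V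
      map_add' := fun A B ↦ by rw [Matrix.mul_add, Matrix.add_mul]
      map_smul' := fun r A ↦ by simp }

theorem congruenceCLM_apply {m n : Type*} [Fintype m] [DecidableEq m] [Fintype n]
    [DecidableEq n] (V : Matrix n m ℂ) (N : Matrix n n ℂ) :
    congruenceCLM V N = Vᴴ * N * V := rfl

/-! ### Gram determinants and their growth under matrix exponentials. -/

section Gram

variable {m n : Type*} [Fintype m] [DecidableEq m] [Fintype n]

/-- The Gram determinant of the columns of a complex matrix. -/
noncomputable def gramDet (V : Matrix n m ℂ) : ℝ := (Vᴴ * V).det.re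

theorem factorial_mul_det_conjTranspose_mul_diagonal_mul [DecidableEq n] (W : Matrix n m ℂ)
    (b : n → ℝ) :
    ((Fintype.card m)! : ℂ) * (Wᴴ * (diagonal (fun i ↦ (b i : ℂ)) * W)).det =
      ((∑ f : m → n, ‖(W.submatrix f id).det‖ ^ 2 * ∏ i, b (f i) : ℝ) : ℂ) := by
  rw [factorial_mul_det_mul, Complex.ofReal_sum]
  refine Finset.sum_congr rfl fun f _ ↦ ?_
  have h1 : Wᴴ.submatrix id f = (W.submatrix f id)ᴴ := rfl
  have h2 : (diagonal (fun i ↦ (b i : ℂ)) * W).submatrix f id =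
      of fun i j ↦ (b (f i) : ℂ) * (W.submatrix f id) i j := by
    ext i j
    simp [diagonal_mul]
  rw [h1, h2, det_mul_column, det_conjTranspose]
  push_cast
  rw [← Complex.conj_mul']
  simp only [Complex.star_def]
  ring

theorem factorial_mul_gramDet (V : Matrix n m ℂ) :
    ((Fintype.card m)! : ℝ) * gramDet V = ∑ f : m → n, ‖(V.submatrix f id).det‖ ^ 2 := by
  classical
  have h := factorial_mul_det_conjTranspose_mul_diagonal_mul V (fun _ ↦ 1)
  simp only [Complex.ofReal_one, diagonal_one, Matrix.one_mul, Finset.prod_const_one,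
    mul_one] at h
  have h' := congrArg Complex.re h
  rwa [← Complex.ofReal_natCast, Complex.re_ofReal_mul, Complex.ofReal_re] at h'

theorem gramDet_nonneg (V : Matrix n m ℂ) : 0 ≤ gramDet V := by
  have h := factorial_mul_gramDet V
  have h0 : (0 : ℝ) ≤ ∑ f : m → n, ‖(V.submatrix f id).det‖ ^ 2 :=
    Finset.sum_nonneg fun _ _ ↦ sq_nonneg _
  rw [← h] at h0
  exact nonneg_of_mul_nonneg_right h0 (by positivity)

theorem gramDet_eq_norm_det_sq (A : Matrix m m ℂ) : gramDet A = ‖A.det‖ ^ 2 := by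
  rw [gramDet, det_mul, det_conjTranspose, Complex.star_def, Complex.conj_mul',
    ← Complex.ofReal_pow, Complex.ofReal_re]

theorem continuous_gramDet_mul (V : Matrix n m ℂ) :
    Continuous fun T : Matrix n n ℂ ↦ gramDet (T * V) := by
  unfold gramDet
  fun_prop

theorem differentiable_det : Differentiable ℝ (det : Matrix m m ℂ → ℂ) := by
  have h (i j : m) : Differentiable ℝ fun M : Matrix m m ℂ ↦ M i j :=
    (LinearMap.toContinuousLinearMap (entryLinearMap ℝ ℂ i j)).differentiable
  simp only [funext (det_apply' (R := ℂ) (n := m))]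
  fun_prop

variable [DecidableEq n]

theorem hasDerivAt_exp_conjTranspose_mul_exp (G : Matrix n n ℂ) (s : ℝ) :
    HasDerivAt (fun t : ℝ ↦ (NormedSpace.exp (t • G))ᴴ * NormedSpace.exp (t • G))
      ((NormedSpace.exp (s • G))ᴴ * (G + Gᴴ) * NormedSpace.exp (s • G)) s := by
  have h : HasDerivAt (fun t : ℝ ↦ NormedSpace.exp (t • G)) (G * NormedSpace.exp (s • G)) s :=
    hasDerivAt_exp_smul_const' G s
  have h2 := h.star.mul h
  convert! h2 using 1
  simp only [star_eq_conjTranspose, conjTranspose_mul]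
  noncomm_ring

/-- In the eigenbasis `U`, `1 + t H` is diagonal, so Cauchy–Binet makes the determinant an explicit
polynomial in `t` with nonnegative weights. -/
theorem hasDerivAt_det_congruence_one_add_smul {H U : Matrix n n ℂ} {a : n → ℝ}
    (hU : U * Uᴴ = 1) (hH : H = U * diagonal (fun i ↦ (a i : ℂ)) * Uᴴ) (X : Matrix n m ℂ) :
    HasDerivAt (fun t : ℝ ↦ (Xᴴ * (1 + t • H) * X).det.re)
      (((Fintype.card m)! : ℝ)⁻¹ *
        ∑ f : m → n, ‖((Uᴴ * X).submatrix f id).det‖ ^ 2 * ∑ i, a (f i)) 0 := by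
  have hfac : ((Fintype.card m)! : ℝ) ≠ 0 := by positivity
  have hval (t : ℝ) : (Xᴴ * (1 + t • H) * X).det.re = ((Fintype.card m)! : ℝ)⁻¹ *
      ∑ f : m → n, ‖((Uᴴ * X).submatrix f id).det‖ ^ 2 * ∏ i, (1 + t * a (f i)) := by
    have h := factorial_mul_det_conjTranspose_mul_diagonal_mul (Uᴴ * X) (fun i ↦ 1 + t * a i)
    have hd : diagonal (fun i ↦ ((1 + t * a i : ℝ) : ℂ)) =
        1 + t • diagonal (fun i ↦ (a i : ℂ)) := by
      ext i j
      by_cases hij : i = j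
      · subst hij; simp
      · simp [hij]
    have hM : (Uᴴ * X)ᴴ * (diagonal (fun i ↦ ((1 + t * a i : ℝ) : ℂ)) * (Uᴴ * X)) =
        Xᴴ * (1 + t • H) * X := by
      have h1 : (1 : Matrix n n ℂ) + t • H =
          U * diagonal (fun i ↦ ((1 + t * a i : ℝ) : ℂ)) * Uᴴ := by
        rw [hd, Matrix.mul_add, Matrix.add_mul, Matrix.mul_one, hU, hH]
        simp
      rw [h1, conjTranspose_mul, conjTranspose_conjTranspose]
      simp only [Matrix.mul_assoc]
    rw [hM] at h
    have h' := congrArg Complex.re h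
    rw [← Complex.ofReal_natCast, Complex.re_ofReal_mul, Complex.ofReal_re] at h'
    rw [← h', inv_mul_cancel_left₀ hfac]
  simp only [funext hval]
  refine HasDerivAt.const_mul _ (HasDerivAt.fun_sum fun f _ ↦ HasDerivAt.const_mul _ ?_)
  have h1 (i : m) : HasDerivAt (fun t : ℝ ↦ 1 + t * a (f i)) (a (f i)) 0 := by
    simpa using ((hasDerivAt_id (0 : ℝ)).mul_const (a (f i))).const_add 1
  simpa using HasDerivAt.fun_finsetProd (u := Finset.univ) fun i _ ↦ h1 i

/-- Along `t ↦ exp (t G) V` the Gram determinant grows at least at the rate `c`, if `c` is a lower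
bound for the sums of `card m` eigenvalues of `G + Gᴴ`. -/
theorem exists_hasDerivAt_gramDet_exp {G U : Matrix n n ℂ} {a : n → ℝ} {c : ℝ}
    (hU : U * Uᴴ = 1) (hH : G + Gᴴ = U * diagonal (fun i ↦ (a i : ℂ)) * Uᴴ)
    (hc : ∀ f : m → n, f.Injective → c ≤ ∑ i, a (f i)) (V : Matrix n m ℂ) (s : ℝ) :
    ∃ D : ℝ, HasDerivAt (fun t : ℝ ↦ gramDet (NormedSpace.exp (t • G) * V)) D s ∧
      c * gramDet (NormedSpace.exp (s • G) * V) ≤ D := by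
  set X := NormedSpace.exp (s • G) * V with hX
  have hfac : ((Fintype.card m)! : ℝ) ≠ 0 := by positivity
  have hWX : Xᴴ * X = (Uᴴ * X)ᴴ * (Uᴴ * X) := by
    rw [conjTranspose_mul Uᴴ, conjTranspose_conjTranspose, Matrix.mul_assoc,
      ← Matrix.mul_assoc U, hU, Matrix.one_mul]
  refine ⟨((Fintype.card m)! : ℝ)⁻¹ *
    ∑ f : m → n, ‖((Uᴴ * X).submatrix f id).det‖ ^ 2 * ∑ i, a (f i), ?_, ?_⟩
  -- The curves `Vᴴ exp(tG)ᴴ exp(tG) V` at `s` and `Xᴴ (1 + t (G + Gᴴ)) X` at `0` share value and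
  -- velocity, so by the chain rule `det` has the same derivative along both; the second is known
  -- explicitly.
  · set L := fderiv ℝ (det : Matrix m m ℂ → ℂ) (Xᴴ * X) with hL
    have hdet : HasFDerivAt (det : Matrix m m ℂ → ℂ) L (Xᴴ * X) :=
      (differentiable_det _).hasFDerivAt
    have e1 := hasDerivAt_det_congruence_one_add_smul hU hH X
    have e2 : HasDerivAt (fun t : ℝ ↦ (Xᴴ * (1 + t • (G + Gᴴ)) * X).det.re)
        (L (Xᴴ * (G + Gᴴ) * X)).re 0 := by
      have hcurve : HasDerivAt (fun t : ℝ ↦ (1 : Matrix n n ℂ) + t • (G + Gᴴ)) (G + Gᴴ) 0 := by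
        simpa using ((hasDerivAt_id (0 : ℝ)).smul_const (G + Gᴴ)).const_add 1
      have h1 := (congruenceCLM X).hasFDerivAt.comp_hasDerivAt (0 : ℝ) hcurve
      have h2 := HasFDerivAt.comp_hasDerivAt_of_eq (0 : ℝ) hdet h1
        (by simp [congruenceCLM_apply])
      exact Complex.reCLM.hasFDerivAt.comp_hasDerivAt (0 : ℝ) h2
    rw [e1.unique e2]
    have h1 := (congruenceCLM V).hasFDerivAt.comp_hasDerivAt s
      (hasDerivAt_exp_conjTranspose_mul_exp G s)
    have h2 := HasFDerivAt.comp_hasDerivAt_of_eq s hdet h1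
      (by simp [congruenceCLM_apply, hX, Matrix.mul_assoc])
    have h3 := Complex.reCLM.hasFDerivAt.comp_hasDerivAt s h2
    convert! h3 using 1
    · ext t
      simp [congruenceCLM_apply, gramDet, Matrix.mul_assoc]
    · simp [congruenceCLM_apply, hX, Matrix.mul_assoc]
  · have hg : gramDet X = ((Fintype.card m)! : ℝ)⁻¹ *
        ∑ f : m → n, ‖((Uᴴ * X).submatrix f id).det‖ ^ 2 := by
      rw [← factorial_mul_gramDet, inv_mul_cancel_left₀ hfac, gramDet, gramDet, hWX]
    rw [hg, mul_left_comm, Finset.mul_sum]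
    refine mul_le_mul_of_nonneg_left (Finset.sum_le_sum fun f _ ↦ ?_) (by positivity)
    -- A non-injective `f` repeats a row, so its minor vanishes and `hc` is needed only for
    -- injective `f`.
    by_cases hf : f.Injective
    · rw [mul_comm]
      exact mul_le_mul_of_nonneg_left (hc f hf) (sq_nonneg _)
    · obtain ⟨i, j, hij, hne⟩ := Function.not_injective_iff.mp hf
      have h0 : ((Uᴴ * X).submatrix f id).det = 0 :=
        det_zero_of_row_eq hne (by ext l; simp [submatrix_apply, hij])
      simp [h0]

theorem exp_mul_gramDet_le {G U : Matrix n n ℂ} {a : n → ℝ} {c : ℝ}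
    (hU : U * Uᴴ = 1) (hH : G + Gᴴ = U * diagonal (fun i ↦ (a i : ℂ)) * Uᴴ)
    (hc : ∀ f : m → n, f.Injective → c ≤ ∑ i, a (f i)) (V : Matrix n m ℂ) :
    Real.exp c * gramDet V ≤ gramDet (NormedSpace.exp G * V) := by
  choose D hD hle using exists_hasDerivAt_gramDet_exp hU hH hc V
  -- Integrating factor: `exp (-c t)` times the Gram determinant is nondecreasing.
  have hder (t : ℝ) := (((hasDerivAt_id t).const_mul (-c)).exp).mul (hD t)
  have hmono := monotone_of_hasDerivAt_nonneg hder fun t ↦ by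
    have h1 := hle t
    have h2 := Real.exp_pos (-c * t)
    simp only [id_eq, mul_one, Pi.zero_apply]
    nlinarith [mul_nonneg h2.le (sub_nonneg.mpr h1)]
  have h := hmono zero_le_one
  simp only [Pi.mul_apply, id_eq, mul_zero, Real.exp_zero, one_mul, zero_smul,
    NormedSpace.exp_zero, Matrix.one_mul, mul_one, one_smul] at h
  calc Real.exp c * gramDet V
      ≤ Real.exp c * (Real.exp (-c) * gramDet (NormedSpace.exp G * V)) := by gcongr
    _ = _ := by rw [← mul_assoc, ← Real.exp_add]; simp

/-- The growth bound for `-G` with `V = 1` square: every injective self-map is a bijection, so `c`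
is exactly minus the trace. Inverting turns the lower bound into an upper one. -/
theorem norm_det_exp_sq_le (G : Matrix n n ℂ) :
    ‖(NormedSpace.exp G).det‖ ^ 2 ≤ Real.exp (G + Gᴴ).trace.re := by
  have hA := isHermitian_add_transpose_self G
  have hsp := hA.spectral_theorem
  rw [Unitary.conjStarAlgAut_apply] at hsp
  have hU : (hA.eigenvectorUnitary : Matrix n n ℂ) * (hA.eigenvectorUnitary : Matrix n n ℂ)ᴴ = 1 :=
    Unitary.coe_mul_star_self _
  have htr : (G + Gᴴ).trace.re = ∑ i, hA.eigenvalues i := by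
    rw [hA.trace_eq_sum_eigenvalues]; simp
  have hH : -G + (-G)ᴴ = (hA.eigenvectorUnitary : Matrix n n ℂ) *
      diagonal (fun i ↦ ((-hA.eigenvalues i : ℝ) : ℂ)) *
        (hA.eigenvectorUnitary : Matrix n n ℂ)ᴴ := by
    have hd : diagonal (fun i ↦ ((-hA.eigenvalues i : ℝ) : ℂ)) =
        -diagonal (RCLike.ofReal ∘ hA.eigenvalues) := by
      ext i j
      by_cases hij : i = j
      · subst hij; simp
      · simp [hij]
    rw [hd, Matrix.mul_neg, Matrix.neg_mul,
      ← star_eq_conjTranspose (hA.eigenvectorUnitary : Matrix n n ℂ), ← hsp, conjTranspose_neg, neg_add]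
  have h := exp_mul_gramDet_le (m := n) (c := -(G + Gᴴ).trace.re) hU hH (fun f hf ↦ by
    rw [htr, (Finite.injective_iff_bijective.mp hf).sum_comp (fun i ↦ -hA.eigenvalues i),
      Finset.sum_neg_distrib]) 1
  rw [gramDet_eq_norm_det_sq, gramDet_eq_norm_det_sq, Matrix.mul_one, det_one, norm_one, one_pow,
    mul_one, exp_neg, det_nonsing_inv, Ring.inverse_eq_inv', norm_inv, inv_pow, Real.exp_neg] at h
  have hne : (NormedSpace.exp G).det ≠ 0 := ((isUnit_iff_isUnit_det _).mp (isUnit_exp G)).ne_zero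
  exact (inv_le_inv₀ (Real.exp_pos _) (by positivity)).mp h

end Gram

end Matrix

/-! ### Sums of the smallest eigenvalues. -/

theorem Fin.le_apply_of_strictMono {k d : ℕ} {e : Fin k → Fin d} (he : StrictMono e) (i : Fin k) :
    (i : ℕ) ≤ e i := by
  obtain ⟨i, hi⟩ := i
  induction i with
  | zero => exact Nat.zero_le _
  | succ j ih =>
    have h1 := ih (Nat.lt_of_succ_lt hi)
    have h2 : e ⟨j, Nat.lt_of_succ_lt hi⟩ < e ⟨j + 1, hi⟩ := he (Nat.lt_succ_self j)
    exact Nat.succ_le_of_lt (h1.trans_lt h2)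

/-- After sorting, the `i`-th element of the image of `f` is at least `i`. -/
theorem Monotone.sum_castLE_le_sum_comp {k d : ℕ} (hkd : k ≤ d) {a : Fin d → ℝ} (ha : Monotone a)
    {f : Fin k → Fin d} (hf : f.Injective) :
    ∑ i, a (Fin.castLE hkd i) ≤ ∑ i, a (f i) := by
  classical
  have hcard : (Finset.univ.image f).card = k := by
    rw [Finset.card_image_of_injective _ hf, Finset.card_univ, Fintype.card_fin]
  set e := (Finset.univ.image f).orderEmbOfFin hcard with he
  calc ∑ i, a (Fin.castLE hkd i) ≤ ∑ i, a (e i) :=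
        Finset.sum_le_sum fun i _ ↦ ha (Fin.le_apply_of_strictMono e.strictMono i)
    _ = ∑ x ∈ Finset.univ.image e, a x := (Finset.sum_image e.injective.injOn).symm
    _ = ∑ x ∈ Finset.univ.image f, a x := by rw [he, Finset.image_orderEmbOfFin_univ]
    _ = ∑ i, a (f i) := Finset.sum_image hf.injOn

/-! ### Volume expansion and singular values. -/

namespace MarkovDiv

variable {d k : ℕ}

theorem monotone_eigAsc {A : Matrix (Fin d) (Fin d) ℂ} (hA : A.IsHermitian) :
    Monotone (eigAsc hA) := fun _ _ hij ↦
  hA.eigenvalues₀_antitone (by simpa [Fin.le_def] using Fin.rev_le_rev.mpr hij)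

theorem sum_eigAsc_le_sum_eigenvalues (hkd : k ≤ d) {A : Matrix (Fin d) (Fin d) ℂ}
    (hA : A.IsHermitian) {f : Fin k → Fin d} (hf : f.Injective) :
    ∑ i : Fin k, eigAsc hA (Fin.castLE hkd i) ≤ ∑ i, hA.eigenvalues (f i) := by
  -- `eigenvalues` is indexed through a chosen equivalence with `Fin (card _)`; `σ` translates that
  -- index into the increasing order.
  let σ : Fin d → Fin d := fun j ↦ (Fin.cast (Fintype.card_fin d)
    ((Fintype.equivOfCardEq (Fintype.card_fin (Fintype.card (Fin d)))).symm j)).rev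
  have hσ : σ.Injective := fun i j hij ↦ by
    simpa [σ] using hij
  have h (j : Fin d) : hA.eigenvalues j = eigAsc hA (σ j) := by
    simp [eigAsc, σ, Matrix.IsHermitian.eigenvalues]
  simp only [h]
  exact (monotone_eigAsc hA).sum_castLE_le_sum_comp hkd (hσ.comp hf)

/-- `T` changes the Gram determinant of any `k` vectors by at least the factor
`|det T| ^ (2 / p)`. -/
def ExpandsVolume (k : ℕ) (p : ℝ) (T : Matrix (Fin d) (Fin d) ℂ) : Prop :=
  ∀ V : Matrix (Fin d) (Fin k) ℂ,
    ‖T.det‖ ^ 2 * Matrix.gramDet V ^ p ≤ Matrix.gramDet (T * V) ^ p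

theorem ExpandsVolume.mul {p : ℝ} {A B : Matrix (Fin d) (Fin d) ℂ} (hA : ExpandsVolume k p A)
    (hB : ExpandsVolume k p B) : ExpandsVolume k p (A * B) := fun V ↦ by
  calc ‖(A * B).det‖ ^ 2 * Matrix.gramDet V ^ p
      = ‖A.det‖ ^ 2 * (‖B.det‖ ^ 2 * Matrix.gramDet V ^ p) := by
        rw [Matrix.det_mul, norm_mul]; ring
    _ ≤ ‖A.det‖ ^ 2 * Matrix.gramDet (B * V) ^ p := by gcongr; exact hB V
    _ ≤ Matrix.gramDet (A * (B * V)) ^ p := hA _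
    _ = Matrix.gramDet (A * B * V) ^ p := by rw [Matrix.mul_assoc]

theorem expandsVolume_one {p : ℝ} : ExpandsVolume k p (1 : Matrix (Fin d) (Fin d) ℂ) := fun V ↦ by
  simp

theorem isClosed_expandsVolume {p : ℝ} (hp : 0 < p) :
    IsClosed {T : Matrix (Fin d) (Fin d) ℂ | ExpandsVolume k p T} := by
  simp only [ExpandsVolume, Set.ofPred_forall]
  refine isClosed_iInter fun V ↦ isClosed_le (by fun_prop) ?_
  exact (Matrix.continuous_gramDet_mul V).rpow_const fun _ ↦ Or.inr hp.le

theorem expandsVolume_exp (hkd : k ≤ d) {p : ℝ} (hp : 0 < p) {G : Matrix (Fin d) (Fin d) ℂ}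
    (hG : (G + Gᴴ).trace.re
      - p * ∑ i : Fin k, eigAsc (Matrix.isHermitian_add_transpose_self G)
          (Fin.castLE hkd i) ≤ 0) :
    ExpandsVolume k p (NormedSpace.exp G) := fun V ↦ by
  have hA := Matrix.isHermitian_add_transpose_self G
  have hsp := hA.spectral_theorem
  rw [Unitary.conjStarAlgAut_apply] at hsp
  have h := Matrix.exp_mul_gramDet_le (Unitary.coe_mul_star_self hA.eigenvectorUnitary) hsp
    (fun f hf ↦ sum_eigAsc_le_sum_eigenvalues hkd hA (f := f) hf) V
  set c := ∑ i : Fin k, eigAsc hA (Fin.castLE hkd i)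
  have hV := Matrix.gramDet_nonneg V
  calc ‖(NormedSpace.exp G).det‖ ^ 2 * Matrix.gramDet V ^ p
      ≤ Real.exp (c * p) * Matrix.gramDet V ^ p := by
        gcongr
        refine (Matrix.norm_det_exp_sq_le G).trans (Real.exp_le_exp.mpr ?_)
        linarith
    _ = (Real.exp c * Matrix.gramDet V) ^ p := by
        rw [Real.mul_rpow (Real.exp_pos _).le hV, Real.exp_mul]
    _ ≤ _ := by gcongr

/-- Right singular vectors of the `k` smallest singular values realize their product. -/
theorem exists_gramDet_eq_prod_singAsc (hkd : k ≤ d) (T : Matrix (Fin d) (Fin d) ℂ) :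
    ∃ V : Matrix (Fin d) (Fin k) ℂ, Matrix.gramDet V = 1 ∧
      Matrix.gramDet (T * V) = (∏ i : Fin k, singAsc T (Fin.castLE hkd i)) ^ 2 := by
  have hS := (Matrix.toEuclideanLin T).isSymmetric_adjoint_comp_self
  have hd : Module.finrank ℂ (EuclideanSpace ℂ (Fin d)) = d := finrank_euclideanSpace_fin
  let b := hS.eigenvectorBasis hd
  -- The basis `b` is ordered by decreasing eigenvalues of `T* T`; reversing the index selects the
  -- `k` smallest.
  let r : Fin k → Fin d := fun j ↦ (Fin.castLE hkd j).rev
  have hr : r.Injective := Fin.rev_injective.comp (Fin.castLE_injective hkd)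
  let V : Matrix (Fin d) (Fin k) ℂ := Matrix.of fun i j ↦ b (r j) i
  have hV : Vᴴ * V = 1 := by
    ext i j
    have h := orthonormal_iff_ite.mp b.orthonormal (r i) (r j)
    rw [EuclideanSpace.inner_eq_star_dotProduct] at h
    simp only [hr.eq_iff] at h
    rw [Matrix.one_apply, ← h]
    simp only [Matrix.mul_apply, dotProduct]
    exact Finset.sum_congr rfl fun l _ ↦ mul_comm (G := ℂ) _ _
  have hTV : (T * V)ᴴ * (T * V) =
      Matrix.diagonal fun i ↦ ((singAsc T (Fin.castLE hkd i) ^ 2 : ℝ) : ℂ) := by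
    ext i j
    have h : inner ℂ (Matrix.toEuclideanLin T (b (r i))) (Matrix.toEuclideanLin T (b (r j))) =
        if i = j then ((singAsc T (Fin.castLE hkd i) ^ 2 : ℝ) : ℂ) else 0 := by
      rw [← LinearMap.adjoint_inner_right, ← LinearMap.comp_apply, hS.apply_eigenvectorBasis hd,
        inner_smul_right, orthonormal_iff_ite.mp b.orthonormal (r i) (r j),
        ← LinearMap.sq_singularValues_fin _ hd]
      simp only [hr.eq_iff]
      split_ifs with hij
      · subst hij; simp [singAsc, r]
      · simp
    rw [Matrix.diagonal_apply, ← h, EuclideanSpace.inner_eq_star_dotProduct]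
    simp only [Matrix.mul_apply, dotProduct]
    exact Finset.sum_congr rfl fun l _ ↦ mul_comm (G := ℂ) _ _
  refine ⟨V, by simp [Matrix.gramDet, hV], ?_⟩
  rw [Matrix.gramDet, hTV, Matrix.det_diagonal, ← Complex.ofReal_prod, Complex.ofReal_re,
    Finset.prod_pow]

theorem ExpandsVolume.norm_det_le (hkd : k ≤ d) {p : ℝ} {T : Matrix (Fin d) (Fin d) ℂ}
    (hT : ExpandsVolume k p T) :
    ‖T.det‖ ≤ (∏ i : Fin k, singAsc T (Fin.castLE hkd i)) ^ p := by
  obtain ⟨V, hV, hTV⟩ := exists_gramDet_eq_prod_singAsc hkd T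
  have hs : 0 ≤ ∏ i : Fin k, singAsc T (Fin.castLE hkd i) :=
    Finset.prod_nonneg fun _ _ ↦ LinearMap.singularValues_nonneg _ _
  have h := hT V
  rw [hV, hTV, Real.one_rpow, mul_one, ← Real.rpow_natCast_mul hs, mul_comm,
    Real.rpow_mul_natCast hs] at h
  exact le_of_sq_le_sq h (Real.rpow_nonneg hs p)

end MarkovDiv

theorem theorem4p4 {d k : ℕ} (hk : 1 ≤ k) (hkd : k ≤ d) {p : ℝ} (hp : 0 < p)
    (𝒢 : Set (Matrix (Fin d) (Fin d) ℂ))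
    (h𝒢 : ∀ G ∈ 𝒢, (G + G.conjTranspose).trace.re
      - p * ∑ i : Fin k, MarkovDiv.eigAsc (Matrix.isHermitian_add_transpose_self G)
          (Fin.castLE hkd i) ≤ 0)
    (T : Matrix (Fin d) (Fin d) ℂ) (hT : MarkovDiv.MarkovianDivisible 𝒢 T) :
    ‖T.det‖ ≤ (∏ i : Fin k, MarkovDiv.singAsc T (Fin.castLE hkd i)) ^ p := by
  refine MarkovDiv.ExpandsVolume.norm_det_le hkd (p := p) ?_
  refine closure_minimal ?_ (MarkovDiv.isClosed_expandsVolume hp) hT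
  rintro _ ⟨n, -, G, hG, rfl⟩
  refine List.prod_induction (MarkovDiv.ExpandsVolume k p) (fun _ _ ↦ .mul)
    MarkovDiv.expandsVolume_one fun A hA ↦ ?_
  obtain ⟨i, rfl⟩ := List.mem_ofFn.mp hA
  exact MarkovDiv.expandsVolume_exp hkd hp (h𝒢 _ (hG i))
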